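/- Let $W_1, W_2, \ldots$ and $U_1, U_2, \ldots$ be mutually independent random variables, all uniformly distributed on $[0,1]$. Let $P_i := (1-W_1)\cdots(1-W_{i-1})W_i$ be the interval lengths of the GEM$(1)$ (uniform stick-breaking) model, and put $R_0 := 0$, $R_k := P_1 + \cdots + P_k = 1-\prod_{i=1}^k(1-W_i)$, so that $I_k := [R_{k-1}, R_k)$ is the $k$-th interval. For $n, k \ge 0$ let $$Q_n^*(k) := \sum_{i=1}^n 1(U_i \ge R_k)$$ be the number of the first $n$ sample points $U_1,\dots,U_n$ which lie outside $[0,R_k)$, the union of the first $k$ intervals, and let $n(k,1) := \min\{n : Q_n^*(k) = 1\}$ be the first time at which a sample point falls outside the first $k$ intervals (this is finite almost surely). For $k \ge 1$ let $$C_k^{1,1} := \sum_{j=1}^k 1\{Q^*_{n(k,1)}(j) = Q^*_{n(k,1)}(j-1)\}$$ be the number of empty intervals among the first $k$ intervals at the time $n(k,1)$. Then $$\mathbb{E}\, C_k^{1,1} = \begin{cases} \tfrac12 + k - (k-1)\,\zeta(k) & \text{for } k \ge 2,\\ \tfrac12 & \text{for } k = 1,\end{cases}$$ where $\zeta$ is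 the Riemann zeta function. -/

import Mathlib

open MeasureTheory ProbabilityTheory

namespace StickBreaking

/-- Interval lengths `P_{i+1} = (1 - W_1) ⋯ (1 - W_i) W_{i+1}`, where `w i` stands for `W_{i+1}`. -/
def length (w : ℕ → ℝ) (i : ℕ) : ℝ :=
  (∏ j ∈ Finset.range i, (1 - w j)) * w i

/-- Right end points `R_k = P_1 + ⋯ + P_k`, with `R_0 = 0`; the `k`-th interval is
`[R_{k-1}, R_k)`. -/
def endpoint (w : ℕ → ℝ) (k : ℕ) : ℝ :=
  ∑ i ∈ Finset.range k, length w i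

theorem endpoint_eq (w : ℕ → ℝ) (k : ℕ) :
    endpoint w k = 1 - ∏ i ∈ Finset.range k, (1 - w i) := by
  induction k with
  | zero => simp [endpoint]
  | succ k ih =>
    rw [endpoint, Finset.sum_range_succ, ← endpoint, ih, Finset.prod_range_succ, length]
    ring

/-- `Q*_n(k)`: the number of the first `n` sample points `U_1, …, U_n` (`u i` stands for `U_{i+1}`)
that lie outside the union `[0, R_k)` of the first `k` intervals. -/
noncomputable def outsideCount (w u : ℕ → ℝ) (n k : ℕ) : ℕ :=
  ((Finset.range n).filter fun i => endpoint w k ≤ u i).card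

/-- `n(k, m)`: the first time `n` at which `m` of the sample points lie outside the first `k`
intervals (with value `0` if there is no such time, an event of probability zero in the model). -/
noncomputable def hittingTime (w u : ℕ → ℝ) (k m : ℕ) : ℕ :=
  sInf {n : ℕ | outsideCount w u n k = m}

/-- `C_k^ℓ`: the number of `j ∈ {1, …, k}` with `Q*_{n(k,ℓ)}(j) = Q*_{n(k,ℓ)}(j-1)`, that is, of
intervals among the first `k` that contain no sample point at time `n(k, ℓ)`. -/
noncomputable def emptyCount (w u : ℕ → ℝ) (ℓ k : ℕ) : ℕ :=
  ∑ j ∈ Finset.Icc 1 k,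
    if outsideCount w u (hittingTime w u k ℓ) j = outsideCount w u (hittingTime w u k ℓ) (j - 1)
    then 1 else 0

/-- Sampling from the GEM(1) model: the stick-breaking factors `W_1, W_2, …` and the sample points
`U_1, U_2, …` are all uniformly distributed on `[0, 1]` and are all mutually independent. -/
structure IsGEMOneSample {Ω : Type*} [MeasurableSpace Ω] (P : Measure Ω)
    (W U : ℕ → Ω → ℝ) : Prop where
  measurable_W : ∀ i, Measurable (W i)
  measurable_U : ∀ i, Measurable (U i)
  uniform_W : ∀ i, pdf.IsUniform (W i) (Set.Icc 0 1) P volume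
  uniform_U : ∀ i, pdf.IsUniform (U i) (Set.Icc 0 1) P volume
  indep : iIndepFun (Sum.elim W U) P

end StickBreaking

/-! Condition on `W`. Up to the first entry into `[R_k, 1]`, the sample points are i.i.d. trials.
The interval `[R_j, R_{j+1})` stays empty exactly when all earlier points avoid it as well as `[R_k,
1]`, so a geometric series gives the conditional probability `(1 - R_k) / (1 - R_k + P_{j+1})`
(`unif_enter_diff`). Cancelling the factors of index below `j` leaves `1 - w / (w + (1 - w) Y)`,
where `w = W j` is uniform and `Y` is an independent product of `n = k - 1 - j` uniforms
(`empty_ratio_eq`).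

Integrating the fraction over `w` gives `(1 - Y + Y log Y) / (1 - Y)^2`. Expanding `1 / (1 - Y)^2`
as `∑ (m + 1) Y^m` and inserting the moments of `Y` with and without the logarithm produces a zeta
series with sum `n ζ(n+1) - (n-1) ζ(n)` for `n ≥ 2` (`hasSum_integral_ratio`, `hasSum_moments`).
Summing over the intervals, these differences telescope in `n` and leave `(k-1) ζ(k)`
(`sum_emptyProb`). -/

namespace StickBreaking

/-! ### Elementary integrals and zeta series -/

theorem integral_pow_mul_negMulLog (n : ℕ) :
    ∫ x in (0 : ℝ)..1, x ^ n * Real.negMulLog x = 1 / ((n : ℝ) + 2) ^ 2 := by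
  have hn : (n : ℝ) + 2 ≠ 0 := by positivity
  -- Integration by parts; written with `negMulLog`, the antiderivative is continuous at `0`, where
  -- the logarithm is not.
  rw [intervalIntegral.integral_eq_sub_of_hasDerivAt_of_le (f := fun x : ℝ =>
    x ^ (n + 1) * Real.negMulLog x / (n + 2) + x ^ (n + 2) / (n + 2) ^ 2) zero_le_one]
  · simp
  · exact Continuous.continuousOn (by fun_prop)
  · intro x hx
    have hx0 : x ≠ 0 := hx.1.ne'
    have h := (((hasDerivAt_pow (n + 1) x).mul (Real.hasDerivAt_negMulLog hx0)).div_const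
      ((n : ℝ) + 2)).add ((hasDerivAt_pow (n + 2) x).div_const (((n : ℝ) + 2) ^ 2))
    convert! h using 1
    simp only [Real.negMulLog]
    push_cast
    field_simp
    ring
  · exact Continuous.intervalIntegrable (by fun_prop) _ _

/-- The denominator is affine in `w` with slope `1 - y`, so the integrand is a constant minus a
multiple of its reciprocal. -/
theorem integral_div_add_one_sub_mul {y : ℝ} (h0 : 0 < y) (h1 : y < 1) :
    ∫ w in (0 : ℝ)..1, w / (w + (1 - w) * y) =
      (1 - y - Real.negMulLog y) / (1 - y) ^ 2 := by
  have hy : 1 - y ≠ 0 := by linarith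
  have hpos : ∀ w ∈ Set.Icc (0 : ℝ) 1, 0 < w + (1 - w) * y := fun w hw => by
    nlinarith [mul_nonneg hw.1 (sub_nonneg.2 h1.le)]
  rw [intervalIntegral.integral_eq_sub_of_hasDerivAt (f := fun w : ℝ =>
    w / (1 - y) - y / (1 - y) ^ 2 * Real.log (w + (1 - w) * y))]
  · simp [Real.negMulLog]
    field_simp
  · intro w hw
    rw [Set.uIcc_of_le zero_le_one] at hw
    have hp := (hpos w hw).ne'
    have hd : HasDerivAt (fun w : ℝ => w + (1 - w) * y) (1 + (-1) * y) w :=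
      (hasDerivAt_id w).add (((hasDerivAt_id w).const_sub 1).mul_const y)
    have h := ((hasDerivAt_id w).div_const (1 - y)).sub ((hd.log hp).const_mul (y / (1 - y) ^ 2))
    convert! h using 1
    field_simp
    ring
  · refine ContinuousOn.intervalIntegrable ?_
    rw [Set.uIcc_of_le zero_le_one]
    exact ContinuousOn.div (by fun_prop) (by fun_prop) fun w hw => (hpos w hw).ne'

theorem hasSum_succ_mul_pow {y : ℝ} (h0 : 0 ≤ y) (h1 : y < 1) :
    HasSum (fun m : ℕ => ((m : ℝ) + 1) * y ^ m) (1 / (1 - y) ^ 2) := by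
  have hy : 1 - y ≠ 0 := by linarith
  have hn : ‖y‖ < 1 := by rwa [Real.norm_of_nonneg h0]
  convert! (hasSum_coe_mul_geometric_of_norm_lt_one hn).add
    (hasSum_geometric_of_lt_one h0 h1) using 1
  · ext m; ring
  · field_simp; ring

theorem negMulLog_le_one_sub {y : ℝ} (h0 : 0 ≤ y) : Real.negMulLog y ≤ 1 - y := by
  rcases h0.eq_or_lt with rfl | h
  · simp
  · have := Real.log_le_sub_one_of_pos (inv_pos.2 h)
    rw [Real.log_inv] at this
    have h2 := mul_le_mul_of_nonneg_left this h.le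
    rw [mul_sub, mul_inv_cancel₀ h.ne'] at h2
    simp only [Real.negMulLog]
    linarith

/-- The real zeta value `∑ 1 / m ^ n`. -/
noncomputable def zetaSum (n : ℕ) : ℝ := ∑' m : ℕ, 1 / ((m : ℝ) + 1) ^ n

theorem hasSum_zetaSum {n : ℕ} (hn : 2 ≤ n) :
    HasSum (fun m : ℕ => 1 / ((m : ℝ) + 1) ^ n) (zetaSum n) := by
  have h := (summable_nat_add_iff 1).2 (Real.summable_one_div_nat_pow.2 (by omega : 1 < n))
  push_cast at h
  exact h.hasSum

theorem zetaSum_eq_riemannZeta {n : ℕ} (hn : 2 ≤ n) : (zetaSum n : ℂ) = riemannZeta n := by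
  rw [zeta_eq_tsum_one_div_nat_add_one_cpow (by simpa using (by omega : 1 < n)), zetaSum]
  push_cast
  congr 1
  ext m
  simp

theorem hasSum_zetaSum_shift {n : ℕ} (hn : 2 ≤ n) :
    HasSum (fun m : ℕ => 1 / ((m : ℝ) + 2) ^ n) (zetaSum n - 1) := by
  have h := (hasSum_nat_add_iff' 1).2 (hasSum_zetaSum hn)
  simp only [Finset.range_one, Finset.sum_singleton, Nat.cast_zero, zero_add, one_pow,
    div_one] at h
  convert! h using 1
  ext m
  push_cast
  ring_nf

theorem hasSum_telescope (n : ℕ) (hn : 1 ≤ n) :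
    HasSum (fun m : ℕ => 1 / ((m : ℝ) + 1) ^ n - 1 / ((m : ℝ) + 2) ^ n) 1 := by
  rw [hasSum_iff_tendsto_nat_of_nonneg]
  · have h : ∀ N : ℕ, ∑ m ∈ Finset.range N, (1 / ((m : ℝ) + 1) ^ n - 1 / ((m : ℝ) + 2) ^ n) =
        1 - 1 / ((N : ℝ) + 1) ^ n := fun N => by
      have := Finset.sum_range_sub' (fun m : ℕ => 1 / ((m : ℝ) + 1) ^ n) N
      simp only [Nat.cast_zero, zero_add, one_pow, div_one] at this
      rw [← this]
      refine Finset.sum_congr rfl fun m _ => ?_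
      push_cast
      ring_nf
    simp only [h]
    have ht := (tendsto_one_div_add_atTop_nhds_zero_nat (𝕜 := ℝ)).pow n
    rw [zero_pow (by omega)] at ht
    simpa using ht.const_sub 1
  · intro m
    rw [sub_nonneg]
    gcongr
    linarith

/-- The case `n = 1` stands apart because `ζ(1)` diverges; here each term collapses to `1 / (m +
2)^2`. -/
theorem hasSum_moments_one :
    HasSum (fun m : ℕ => ((m : ℝ) + 1) * (1 / ((m : ℝ) + 1) ^ 1 - 1 / ((m : ℝ) + 2) ^ 1 -
      (1 : ℕ) / ((m : ℝ) + 2) ^ (1 + 1))) (zetaSum 2 - 1) := by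
  convert! hasSum_zetaSum_shift (le_refl 2) using 1
  ext m
  push_cast
  field_simp
  ring

/-- Writing `m + 1 = (m + 2) - 1` in the last two fractions splits the series into a telescoping one
with exponent `n - 1` and shifted zeta series with exponents `n` and `n + 1`. -/
theorem hasSum_moments {n : ℕ} (hn : 2 ≤ n) :
    HasSum (fun m : ℕ => ((m : ℝ) + 1) * (1 / ((m : ℝ) + 1) ^ n - 1 / ((m : ℝ) + 2) ^ n -
      n / ((m : ℝ) + 2) ^ (n + 1)))
      (n * zetaSum (n + 1) - (n - 1) * zetaSum n) := by
  obtain ⟨l, rfl⟩ : ∃ l, n = l + 2 := ⟨n - 2, by omega⟩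
  have h := ((hasSum_telescope (l + 1) (by omega)).sub
    ((hasSum_zetaSum_shift (n := l + 2) (by omega)).mul_left ((l : ℝ) + 1))).add
    ((hasSum_zetaSum_shift (n := l + 3) (by omega)).mul_left ((l : ℝ) + 2))
  convert! h using 1
  · ext m
    push_cast
    field_simp
    ring
  · push_cast
    ring

/-- The uniform distribution on `[0, 1]`. -/
noncomputable def unif : Measure ℝ := volume.restrict (Set.Icc 0 1)

instance : IsProbabilityMeasure unif := ⟨by simp [unif]⟩

theorem integral_unif (f : ℝ → ℝ) : ∫ x, f x ∂unif = ∫ x in (0 : ℝ)..1, f x := by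
  rw [unif, integral_Icc_eq_integral_Ioc, intervalIntegral.integral_of_le zero_le_one]

theorem map_one_sub_unif : unif.map (fun x => 1 - x) = unif := by
  have h := (Measure.measurePreserving_sub_left (volume : Measure ℝ) 1).restrict_preimage
    (measurableSet_Icc (a := (0 : ℝ)) (b := 1))
  simp only [Set.preimage_const_sub_Icc, sub_self, sub_zero] at h
  exact h.map_eq

theorem ae_unif : ∀ᵐ x ∂unif, x ∈ Set.Ioo (0 : ℝ) 1 := by
  rw [unif, Measure.restrict_congr_set Ioo_ae_eq_Icc.symm]
  exact ae_restrict_mem measurableSet_Ioo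

/-! ### Products of independent uniform variables -/

variable {Ω : Type*} [MeasurableSpace Ω] {P : Measure Ω}

theorem map_eq_unif {X : Ω → ℝ} (h : pdf.IsUniform X (Set.Icc 0 1) P volume) :
    P.map X = unif := by
  rw [show P.map X = _ from h, ProbabilityTheory.cond, unif]
  simp

theorem ae_mem_Ioo {X : Ω → ℝ} (hX : Measurable X) (h : P.map X = unif) :
    ∀ᵐ ω ∂P, X ω ∈ Set.Ioo (0 : ℝ) 1 :=
  ae_of_ae_map hX.aemeasurable (h ▸ ae_unif)

theorem integral_comp_eq {X : Ω → ℝ} (hX : Measurable X) (h : P.map X = unif) {f : ℝ → ℝ}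
    (hf : Measurable f) : ∫ ω, f (X ω) ∂P = ∫ x in (0 : ℝ)..1, f x := by
  rw [← integral_unif, ← h, integral_map hX.aemeasurable hf.aestronglyMeasurable]

theorem ae_prod_mem_Ioc {V : ℕ → Ω → ℝ} (hV : ∀ i, Measurable (V i))
    (hlaw : ∀ i, P.map (V i) = unif) (s : Finset ℕ) :
    ∀ᵐ ω ∂P, ∏ i ∈ s, V i ω ∈ Set.Ioc (0 : ℝ) 1 := by
  filter_upwards [ae_all_iff.2 fun i => ae_mem_Ioo (hV i) (hlaw i)] with ω h
  exact ⟨Finset.prod_pos fun i _ => (h i).1,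
    Finset.prod_le_one (fun i _ => (h i).1.le) fun i _ => (h i).2.le⟩

theorem ae_prod_mem_Ioo {V : ℕ → Ω → ℝ} (hV : ∀ i, Measurable (V i))
    (hlaw : ∀ i, P.map (V i) = unif) {s : Finset ℕ} (hs : s.Nonempty) :
    ∀ᵐ ω ∂P, ∏ i ∈ s, V i ω ∈ Set.Ioo (0 : ℝ) 1 := by
  filter_upwards [ae_all_iff.2 fun i => ae_mem_Ioo (hV i) (hlaw i)] with ω h
  refine ⟨Finset.prod_pos fun i _ => (h i).1, ?_⟩
  obtain ⟨j, hj⟩ := hs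
  rw [← Finset.mul_prod_erase s _ hj]
  exact mul_lt_one_of_nonneg_of_lt_one_left (h j).1.le (h j).2
    (Finset.prod_le_one (fun i _ => (h i).1.le) fun i _ => (h i).2.le)

theorem indepFun_prod {V : ℕ → Ω → ℝ} (hV : ∀ i, Measurable (V i)) (hind : iIndepFun V P)
    {s : Finset ℕ} {j : ℕ} (hj : j ∉ s) : V j ⟂ᵢ[P] fun ω => ∏ i ∈ s, V i ω := by
  have h := (hind.indepFun_finsetProd_of_notMem hV hj).symm
  convert! h using 1
  ext ω
  simp

theorem integral_prod_pow {V : ℕ → Ω → ℝ} [IsProbabilityMeasure P] (hV : ∀ i, Measurable (V i))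
    (hlaw : ∀ i, P.map (V i) = unif) (hind : iIndepFun V P) (s : Finset ℕ) (m : ℕ) :
    ∫ ω, (∏ i ∈ s, V i ω) ^ m ∂P = 1 / ((m : ℝ) + 1) ^ s.card := by
  induction s using Finset.induction_on with
  | empty => simp
  | insert j s hj ih =>
    have hi := (indepFun_prod hV hind hj).comp (measurable_id.pow_const m)
      (measurable_id.pow_const m)
    have h := hi.integral_fun_mul_eq_mul_integral
      ((hV j).pow_const m).aestronglyMeasurable
      ((Finset.measurable_fun_prod s fun i _ => hV i).pow_const m).aestronglyMeasurable
    simp only [Function.comp_def, id] at h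
    simp only [Finset.prod_insert hj, mul_pow]
    rw [h, ih, integral_comp_eq (f := fun x => x ^ m) (hV j) (hlaw j) (by fun_prop), integral_pow,
      Finset.card_insert_of_notMem hj]
    simp
    field_simp
    ring

theorem integrable_comp_of_continuous {Y : Ω → ℝ} [IsFiniteMeasure P] (hY : Measurable Y)
    (h : ∀ᵐ ω ∂P, Y ω ∈ Set.Icc (0 : ℝ) 1) {f : ℝ → ℝ} (hf : Continuous f) :
    Integrable (fun ω => f (Y ω)) P := by
  obtain ⟨C, hC⟩ := (isCompact_Icc (a := (0 : ℝ)) (b := 1)).exists_bound_of_continuousOn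
    hf.continuousOn
  refine Integrable.of_bound (hf.measurable.comp hY).aestronglyMeasurable C ?_
  filter_upwards [h] with ω hω using hC _ hω

/-- The product rule for `negMulLog` splits off one factor at a time, and independence factors both
resulting expectations. -/
theorem integral_prod_pow_mul_negMulLog {V : ℕ → Ω → ℝ} [IsProbabilityMeasure P]
    (hV : ∀ i, Measurable (V i)) (hlaw : ∀ i, P.map (V i) = unif) (hind : iIndepFun V P)
    (s : Finset ℕ) (m : ℕ) :
    ∫ ω, (∏ i ∈ s, V i ω) ^ m * Real.negMulLog (∏ i ∈ s, V i ω) ∂P =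
      s.card / ((m : ℝ) + 2) ^ (s.card + 1) := by
  induction s using Finset.induction_on with
  | empty => simp
  | insert j s hj ih =>
    have hm : Measurable fun ω => ∏ i ∈ s, V i ω := Finset.measurable_fun_prod s fun i _ => hV i
    have hp := indepFun_prod hV hind hj
    have c1 : Continuous fun x : ℝ => x ^ m * Real.negMulLog x := by fun_prop
    have c2 : Continuous fun x : ℝ => x ^ (m + 1) := by fun_prop
    have b1 := ae_prod_mem_Ioc hV hlaw s
    have b2 := ae_mem_Ioo (hV j) (hlaw j)
    have b1' : ∀ᵐ ω ∂P, ∏ i ∈ s, V i ω ∈ Set.Icc (0 : ℝ) 1 := by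
      filter_upwards [b1] with ω h using ⟨h.1.le, h.2⟩
    have b2' : ∀ᵐ ω ∂P, V j ω ∈ Set.Icc (0 : ℝ) 1 := by
      filter_upwards [b2] with ω h using ⟨h.1.le, h.2.le⟩
    have i1 := hp.comp c1.measurable c2.measurable
    have i2 := hp.comp c2.measurable c1.measurable
    have e1 := i1.integral_fun_mul_eq_mul_integral
      (c1.measurable.comp (hV j)).aestronglyMeasurable (c2.measurable.comp hm).aestronglyMeasurable
    have e2 := i2.integral_fun_mul_eq_mul_integral
      (c2.measurable.comp (hV j)).aestronglyMeasurable (c1.measurable.comp hm).aestronglyMeasurable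
    have j1 := i1.integrable_mul (integrable_comp_of_continuous (hV j) b2' c1)
      (integrable_comp_of_continuous hm b1' c2)
    have j2 := i2.integrable_mul (integrable_comp_of_continuous (hV j) b2' c2)
      (integrable_comp_of_continuous hm b1' c1)
    have hsum := integral_add j1 j2
    simp only [Function.comp_def, Pi.mul_apply] at e1 e2 hsum
    have key : ∀ ω, (V j ω * ∏ i ∈ s, V i ω) ^ m * Real.negMulLog (V j ω * ∏ i ∈ s, V i ω) =
        V j ω ^ m * Real.negMulLog (V j ω) * (∏ i ∈ s, V i ω) ^ (m + 1) +
        V j ω ^ (m + 1) * ((∏ i ∈ s, V i ω) ^ m * Real.negMulLog (∏ i ∈ s, V i ω)) := fun ω => by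
      rw [Real.negMulLog_mul]; ring
    simp only [Finset.prod_insert hj, key]
    rw [hsum, e1, e2, ih, integral_prod_pow hV hlaw hind,
      integral_comp_eq (f := fun x => x ^ m * Real.negMulLog x) (hV j) (hlaw j) c1.measurable,
      integral_comp_eq (f := fun x => x ^ (m + 1)) (hV j) (hlaw j) c2.measurable,
      integral_pow_mul_negMulLog, integral_pow, Finset.card_insert_of_notMem hj]
    push_cast
    rw [show (m : ℝ) + 1 + 1 = m + 2 by ring]
    simp
    field_simp
    ring

/-! ### Expectation of the ratio -/

theorem integral_ratio {X Y : Ω → ℝ} [IsProbabilityMeasure P] (hX : Measurable X)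
    (hY : Measurable Y) (hXu : P.map X = unif) (hY01 : ∀ᵐ ω ∂P, Y ω ∈ Set.Icc (0 : ℝ) 1)
    (hind : X ⟂ᵢ[P] Y) :
    ∫ ω, X ω / (X ω + (1 - X ω) * Y ω) ∂P =
      ∫ ω, (∫ w in (0 : ℝ)..1, w / (w + (1 - w) * Y ω)) ∂P := by
  have hmeas : Measurable fun p : ℝ × ℝ => p.1 / (p.1 + (1 - p.1) * p.2) := by fun_prop
  have hlaw := (indepFun_iff_map_prod_eq_prod_map_map hX.aemeasurable hY.aemeasurable).1 hind
  have hbd : ∀ᵐ ω ∂P, ‖X ω / (X ω + (1 - X ω) * Y ω)‖ ≤ 1 := by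
    filter_upwards [ae_mem_Ioo hX hXu, hY01] with ω h1 h2
    have : 0 ≤ (1 - X ω) * Y ω := mul_nonneg (by linarith [h1.2]) h2.1
    rw [Real.norm_of_nonneg (div_nonneg h1.1.le (by linarith [h1.1]))]
    exact div_le_one_of_le₀ (by linarith) (by linarith [h1.1])
  have hint : Integrable (fun p : ℝ × ℝ => p.1 / (p.1 + (1 - p.1) * p.2))
      ((P.map X).prod (P.map Y)) := by
    rw [← hlaw, integrable_map_measure hmeas.aestronglyMeasurable (hX.prodMk hY).aemeasurable]
    exact Integrable.of_bound (hmeas.comp (hX.prodMk hY)).aestronglyMeasurable 1 hbd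
  have : IsProbabilityMeasure (P.map Y) := Measure.isProbabilityMeasure_map hY.aemeasurable
  have : IsProbabilityMeasure (P.map X) := Measure.isProbabilityMeasure_map hX.aemeasurable
  have hsm : AEStronglyMeasurable (fun y => ∫ x, x / (x + (1 - x) * y) ∂(P.map X)) (P.map Y) :=
    hint.swap.integral_prod_left.aestronglyMeasurable
  calc _ = ∫ p, p.1 / (p.1 + (1 - p.1) * p.2) ∂(P.map fun ω => (X ω, Y ω)) := by
        rw [integral_map (hX.prodMk hY).aemeasurable hmeas.aestronglyMeasurable]
    _ = ∫ y, ∫ x, x / (x + (1 - x) * y) ∂(P.map X) ∂(P.map Y) := by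
        rw [hlaw, integral_prod_symm _ hint]
    _ = _ := by
        rw [integral_map hY.aemeasurable hsm]
        simp only [hXu, integral_unif]

/-- Integrating out `X` leaves `(1 - Y - negMulLog Y) / (1 - Y)^2`, whose expansion in powers of `Y`
is integrated term by term. -/
theorem hasSum_integral_ratio {V : ℕ → Ω → ℝ} [IsProbabilityMeasure P] {X : Ω → ℝ}
    (hX : Measurable X) (hXu : P.map X = unif) (hV : ∀ i, Measurable (V i))
    (hlaw : ∀ i, P.map (V i) = unif) (hind : iIndepFun V P) {s : Finset ℕ} (hs : s.Nonempty)
    (hXs : X ⟂ᵢ[P] fun ω => ∏ i ∈ s, V i ω) :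
    HasSum (fun m : ℕ => ((m : ℝ) + 1) * (1 / ((m : ℝ) + 1) ^ s.card -
        1 / ((m : ℝ) + 2) ^ s.card - s.card / ((m : ℝ) + 2) ^ (s.card + 1)))
      (∫ ω, X ω / (X ω + (1 - X ω) * ∏ i ∈ s, V i ω) ∂P) := by
  set Y : Ω → ℝ := fun ω => ∏ i ∈ s, V i ω
  have hY : Measurable Y := Finset.measurable_fun_prod s fun i _ => hV i
  have hY01 := ae_prod_mem_Ioo hV hlaw hs
  have hYI : ∀ᵐ ω ∂P, Y ω ∈ Set.Icc (0 : ℝ) 1 := by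
    filter_upwards [hY01] with ω h using ⟨h.1.le, h.2.le⟩
  rw [integral_ratio hX hY hXu hYI hXs]
  let F : ℕ → Ω → ℝ := fun m ω =>
    ((m : ℝ) + 1) * (Y ω ^ m - Y ω ^ (m + 1) - Y ω ^ m * Real.negMulLog (Y ω))
  have hFi : ∀ m, Integrable (F m) P := fun m =>
    integrable_comp_of_continuous hY hYI (f := fun y =>
      ((m : ℝ) + 1) * (y ^ m - y ^ (m + 1) - y ^ m * Real.negMulLog y)) (by fun_prop)
  have hFv : ∀ m : ℕ, ∫ ω, F m ω ∂P = ((m : ℝ) + 1) * (1 / ((m : ℝ) + 1) ^ s.card -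
        1 / ((m : ℝ) + 2) ^ s.card - s.card / ((m : ℝ) + 2) ^ (s.card + 1)) := fun m => by
    have a1 := integrable_comp_of_continuous hY hYI (f := fun y => y ^ m) (by fun_prop)
    have a2 := integrable_comp_of_continuous hY hYI (f := fun y => y ^ (m + 1)) (by fun_prop)
    have a3 := integrable_comp_of_continuous hY hYI (f := fun y => y ^ m * Real.negMulLog y)
      (by fun_prop)
    simp only [F]
    have e := integral_sub (a1.sub a2) a3
    simp only [Pi.sub_apply] at e
    rw [integral_const_mul, e, integral_sub a1 a2,
      integral_prod_pow hV hlaw hind, integral_prod_pow hV hlaw hind,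
      integral_prod_pow_mul_negMulLog hV hlaw hind]
    push_cast
    rw [show (m : ℝ) + 1 + 1 = m + 2 by ring]
  have hnn : ∀ m, 0 ≤ᵐ[P] F m := fun m => by
    filter_upwards [hYI] with ω h
    have h1 := negMulLog_le_one_sub h.1
    have : F m ω = ((m : ℝ) + 1) * (Y ω ^ m * (1 - Y ω - Real.negMulLog (Y ω))) := by
      simp only [F]; ring
    rw [this]
    exact mul_nonneg (by positivity) (mul_nonneg (pow_nonneg h.1 m) (by linarith))
  -- Since the terms are nonnegative, convergence of the moment series already justifies exchanging
  -- sum and integral.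
  have hnorm : ∀ m, ∫ ω, ‖F m ω‖ ∂P = ∫ ω, F m ω ∂P := fun m =>
    integral_congr_ae <| by filter_upwards [hnn m] with ω h using Real.norm_of_nonneg h
  have hsumm : Summable fun m => ∫ ω, ‖F m ω‖ ∂P := by
    simp only [hnorm, hFv]
    rcases eq_or_lt_of_le (Nat.one_le_iff_ne_zero.2 (Finset.card_pos.2 hs).ne') with h | h
    · rw [← h]; exact hasSum_moments_one.summable
    · exact (hasSum_moments h).summable
  have h := hasSum_integral_of_summable_integral_norm hFi hsumm
  simp only [hFv] at h
  convert! h using 1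
  refine integral_congr_ae ?_
  filter_upwards [hY01] with ω hω
  change Y ω ∈ _ at hω
  rw [integral_div_add_one_sub_mul hω.1 hω.2]
  refine (HasSum.tsum_eq ?_).symm
  convert! (hasSum_succ_mul_pow hω.1.le hω.2).mul_left (1 - Y ω - Real.negMulLog (Y ω)) using 1
  · ext m; simp only [F]; ring
  · ring

theorem integral_ratio_empty {X : Ω → ℝ} (hX : Measurable X) (hXu : P.map X = unif) :
    ∫ ω, X ω / (X ω + (1 - X ω) * 1) ∂P = 1 / 2 := by
  simp only [mul_one, add_sub_cancel, div_one]
  rw [integral_comp_eq (f := fun x => x) hX hXu measurable_id]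
  simp

/-! ### First entrance of an i.i.d. sequence -/

/-- The sequences that enter `T` at some time and lie in `S` at all earlier times. -/
def enterThrough (S T : Set ℝ) : Set (ℕ → ℝ) := {u | ∃ m, u m ∈ T ∧ ∀ i < m, u i ∈ S}

/-- Disjointness of `S` and `T` makes the entry time unique, so the event is a disjoint union of
cylinders of mass `μ T * μ S ^ m`: a geometric series. -/
theorem infinitePi_enterThrough (μ : Measure ℝ) [IsProbabilityMeasure μ] {S T : Set ℝ}
    (hS : MeasurableSet S) (hT : MeasurableSet T) (hST : Disjoint S T) :
    Measure.infinitePi (fun _ : ℕ => μ) (enterThrough S T) = μ T * (1 - μ S)⁻¹ := by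
  let t : ℕ → ℕ → Set ℝ := fun m i => if i < m then S else T
  have ht : ∀ m i, MeasurableSet (t m i) := fun m i => by
    simp only [t]; split_ifs <;> assumption
  have hU : enterThrough S T = ⋃ m, Set.pi ↑(Finset.range (m + 1)) (t m) := by
    ext u
    simp only [enterThrough, Set.mem_ofPred_eq, Set.mem_iUnion, Set.mem_pi, Finset.coe_range,
      Set.mem_Iio, t]
    refine exists_congr fun m => ⟨fun h i hi => ?_, fun h => ⟨?_, fun i hi => ?_⟩⟩
    · split_ifs with hm
      · exact h.2 i hm
      · obtain rfl : i = m := by omega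
        exact h.1
    · simpa using h m (by omega)
    · simpa [hi] using h i (by omega)
  have hlt : ∀ m n, m < n → Disjoint (Set.pi (↑(Finset.range (m + 1))) (t m))
      (Set.pi ↑(Finset.range (n + 1)) (t n)) := fun m n hmn => by
    rw [Set.disjoint_left]
    intro u hu hu'
    have h1 := hu m (by simp)
    have h2 := hu' m (by simp; omega)
    simp only [t, lt_irrefl, hmn, if_true, if_false] at h1 h2
    exact Set.disjoint_left.1 hST h2 h1
  rw [hU, measure_iUnion]
  · have hm : ∀ m, Measure.infinitePi (fun _ : ℕ => μ) (Set.pi ↑(Finset.range (m + 1)) (t m)) =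
        μ T * μ S ^ m := fun m => by
      rw [Measure.infinitePi_pi _ fun i _ => ht m i, Finset.prod_range_succ,
        Finset.prod_congr rfl (g := fun _ => μ S) fun i hi => by
          simp [t, Finset.mem_range.1 hi]]
      simp [t, mul_comm]
    simp only [hm]
    rw [ENNReal.tsum_mul_left, ENNReal.tsum_geometric]
  · intro m n hmn
    rcases lt_or_gt_of_ne hmn with h | h
    · exact hlt m n h
    · exact (hlt n m h).symm
  · exact fun m => MeasurableSet.pi (Finset.countable_toSet _) fun i _ => ht m i

/-! ### Empty intervals as entrance events -/

section Deterministic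

variable {w u : ℕ → ℝ}

theorem endpoint_mono (hw : ∀ i, w i ∈ Set.Icc (0 : ℝ) 1) : Monotone (endpoint w) := by
  refine monotone_nat_of_le_succ fun k => ?_
  rw [endpoint, endpoint, Finset.sum_range_succ, length]
  have : 0 ≤ (∏ j ∈ Finset.range k, (1 - w j)) * w k :=
    mul_nonneg (Finset.prod_nonneg fun i _ => sub_nonneg.2 (hw i).2) (hw k).1
  linarith

theorem outsideCount_succ (n k : ℕ) :
    outsideCount w u (n + 1) k = outsideCount w u n k + if endpoint w k ≤ u n then 1 else 0 := by
  rw [outsideCount, outsideCount, Finset.range_add_one, Finset.filter_insert]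
  split_ifs <;> simp

theorem hittingTime_one {k m : ℕ} (hm : endpoint w k ≤ u m) (hlt : ∀ i < m, u i < endpoint w k) :
    -- Indices start at `0`: the point `u m` is counted only from time `m + 1` on.
    hittingTime w u k 1 = m + 1 := by
  have h0 : ∀ n ≤ m, outsideCount w u n k = 0 := fun n hn => by
    rw [outsideCount, Finset.card_eq_zero, Finset.filter_eq_empty_iff]
    exact fun i hi => not_le.2 (hlt i ((Finset.mem_range.1 hi).trans_le hn))
  have h1 : outsideCount w u (m + 1) k = 1 := by
    rw [outsideCount_succ, h0 m le_rfl, if_pos hm]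
  refine le_antisymm (Nat.sInf_le h1) (le_csInf ⟨_, h1⟩ fun n hn => ?_)
  by_contra! hlt
  have := h0 n (by omega)
  rw [Set.mem_ofPred_eq] at hn
  omega

/-- The two counted sets are nested, so equal cardinalities force equality. -/
theorem outsideCount_eq_iff {n a b : ℕ} (hab : endpoint w a ≤ endpoint w b) :
    outsideCount w u n b = outsideCount w u n a ↔
      ∀ i < n, u i ∉ Set.Ico (endpoint w a) (endpoint w b) := by
  have hsub : (Finset.range n).filter (fun i => endpoint w b ≤ u i) ⊆
      (Finset.range n).filter (fun i => endpoint w a ≤ u i) := fun i hi => by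
    rw [Finset.mem_filter] at hi ⊢
    exact ⟨hi.1, hab.trans hi.2⟩
  constructor
  · intro h i hi hmem
    have heq := Finset.eq_of_subset_of_card_le hsub h.ge
    have : i ∈ (Finset.range n).filter (fun i => endpoint w b ≤ u i) := by
      rw [heq, Finset.mem_filter]
      exact ⟨Finset.mem_range.2 hi, hmem.1⟩
    exact absurd (Finset.mem_filter.1 this).2 (not_le.2 hmem.2)
  · intro h
    refine congrArg Finset.card (hsub.antisymm fun i hi => ?_)
    rw [Finset.mem_filter] at hi ⊢
    refine ⟨hi.1, ?_⟩
    by_contra! hlt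
    exact h i (Finset.mem_range.1 hi.1) ⟨hi.2, hlt⟩

/-- The sample-point sequences for which the interval `[R_j, R_{j+1})` is empty when the first
point falls outside the first `k` intervals. -/
def emptyEvent (w : ℕ → ℝ) (k j : ℕ) : Set (ℕ → ℝ) :=
  enterThrough (Set.Iio (endpoint w k) \ Set.Ico (endpoint w j) (endpoint w (j + 1)))
    (Set.Ici (endpoint w k))

theorem outsideCount_hittingTime_iff (hw : ∀ i, w i ∈ Set.Icc (0 : ℝ) 1) {k j : ℕ} (hj : j < k)
    (hu : u ∈ enterThrough (Set.Iio (endpoint w k)) (Set.Ici (endpoint w k))) :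
    outsideCount w u (hittingTime w u k 1) (j + 1) = outsideCount w u (hittingTime w u k 1) j ↔
      u ∈ emptyEvent w k j := by
  obtain ⟨m, hm, hlt⟩ := hu
  simp only [Set.mem_Iio, Set.mem_Ici] at hm hlt
  have hmono := endpoint_mono hw
  rw [hittingTime_one hm hlt, outsideCount_eq_iff (hmono (by omega))]
  constructor
  · exact fun h => ⟨m, hm, fun i hi => ⟨hlt i hi, h i (by omega)⟩⟩
  · rintro ⟨m', hm', h'⟩ i hi
    simp only [Set.mem_Ici] at hm'
    have : m' = m := by
      rcases lt_trichotomy m' m with h | h | h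
      · exact absurd hm' (not_le.2 (hlt _ h))
      · exact h
      · exact absurd hm (not_le.2 (h' _ h).1)
    subst this
    rcases Nat.lt_succ_iff_lt_or_eq.1 hi with h | rfl
    · exact (h' i h).2
    -- The entering point itself is counted at the hitting time, but it lies beyond `R_k ≥ R_{j+1}`.
    · exact fun hmem => absurd hm (not_le.2 (hmem.2.trans_le (hmono (by omega))))

theorem emptyCount_eq_sum_indicator (hw : ∀ i, w i ∈ Set.Icc (0 : ℝ) 1) {k : ℕ}
    (hu : u ∈ enterThrough (Set.Iio (endpoint w k)) (Set.Ici (endpoint w k))) :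
    (emptyCount w u 1 k : ℝ) =
      ∑ j ∈ Finset.range k, (emptyEvent w k j).indicator (fun _ => (1 : ℝ)) u := by
  classical
  rw [emptyCount, ← Finset.Ico_succ_right_eq_Icc, Finset.sum_Ico_eq_sum_range]
  push_cast
  refine Finset.sum_congr (by simp) fun j hj => ?_
  rw [Set.indicator_apply, add_comm 1 j, Nat.add_sub_cancel]
  have hj' : j < k := by simpa using hj
  simp only [outsideCount_hittingTime_iff hw hj' hu]

end Deterministic

/-! ### Measurability -/

section Measurability

theorem measurable_endpoint (k : ℕ) : Measurable fun w : ℕ → ℝ => endpoint w k := by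
  simp only [endpoint_eq]
  fun_prop

theorem measurableSet_enterThrough {α : Type*} [MeasurableSpace α] {S T : α → Set ℝ}
    {v : α → ℕ → ℝ} (hS : ∀ i, MeasurableSet {a | v a i ∈ S a})
    (hT : ∀ i, MeasurableSet {a | v a i ∈ T a}) :
    MeasurableSet {a | v a ∈ enterThrough (S a) (T a)} := by
  have : {a | v a ∈ enterThrough (S a) (T a)} =
      ⋃ m : ℕ, {a | v a m ∈ T a} ∩ ⋂ i : ℕ, ⋂ _ : i < m, {a | v a i ∈ S a} := by
    ext a
    simp [enterThrough]
  rw [this]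
  exact MeasurableSet.iUnion fun m => (hT m).inter <|
    MeasurableSet.iInter fun i => MeasurableSet.iInter fun _ => hS i

theorem measurable_endpoint_fst (k : ℕ) :
    Measurable fun p : (ℕ → ℝ) × (ℕ → ℝ) => endpoint p.1 k :=
  (measurable_endpoint k).comp measurable_fst

theorem measurable_snd_eval (i : ℕ) : Measurable fun p : (ℕ → ℝ) × (ℕ → ℝ) => p.2 i := by
  fun_prop

theorem measurableSet_enter (k : ℕ) : MeasurableSet
    {p : (ℕ → ℝ) × (ℕ → ℝ) |
      p.2 ∈ enterThrough (Set.Iio (endpoint p.1 k)) (Set.Ici (endpoint p.1 k))} :=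
  measurableSet_enterThrough
    (fun i => measurableSet_lt (measurable_snd_eval i) (measurable_endpoint_fst k))
    (fun i => measurableSet_le (measurable_endpoint_fst k) (measurable_snd_eval i))

theorem measurableSet_emptyEvent (k j : ℕ) : MeasurableSet
    {p : (ℕ → ℝ) × (ℕ → ℝ) | p.2 ∈ emptyEvent p.1 k j} :=
  measurableSet_enterThrough
    (fun i => (measurableSet_lt (measurable_snd_eval i) (measurable_endpoint_fst k)).inter
      ((measurableSet_le (measurable_endpoint_fst j) (measurable_snd_eval i)).inter
        (measurableSet_lt (measurable_snd_eval i) (measurable_endpoint_fst (j + 1)))).compl)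
    (fun i => measurableSet_le (measurable_endpoint_fst k) (measurable_snd_eval i))

end Measurability

/-! ### Conditional probabilities given the stick-breaking factors -/

theorem unif_apply {a b : ℝ} (ha : 0 ≤ a) (hb : b ≤ 1) :
    unif (Set.Ico a b) = ENNReal.ofReal (b - a) := by
  rw [unif, Measure.restrict_apply measurableSet_Ico, Set.inter_eq_left.2, Real.volume_Ico]
  exact fun x hx => ⟨ha.trans hx.1, hx.2.le.trans hb⟩

theorem unif_Iio {r : ℝ} (hr : r ≤ 1) : unif (Set.Iio r) = ENNReal.ofReal r := by
  rw [unif, Measure.restrict_apply measurableSet_Iio,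
    show Set.Iio r ∩ Set.Icc 0 1 = Set.Ico 0 r from ?_, Real.volume_Ico, sub_zero]
  ext x
  simp only [Set.mem_inter_iff, Set.mem_Iio, Set.mem_Icc, Set.mem_Ico]
  constructor
  · exact fun h => ⟨h.2.1, h.1⟩
  · exact fun h => ⟨h.2, h.1, h.2.le.trans hr⟩

theorem unif_Ici {r : ℝ} (h0 : 0 ≤ r) (hr : r ≤ 1) :
    unif (Set.Ici r) = ENNReal.ofReal (1 - r) := by
  rw [← Set.compl_Iio, prob_compl_eq_one_sub measurableSet_Iio, unif_Iio hr,
    ENNReal.ofReal_sub _ h0, ENNReal.ofReal_one]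

theorem unif_enter {r : ℝ} (h0 : 0 ≤ r) (hr : r < 1) :
    Measure.infinitePi (fun _ : ℕ => unif) (enterThrough (Set.Iio r) (Set.Ici r)) = 1 := by
  rw [infinitePi_enterThrough _ measurableSet_Iio measurableSet_Ici
      (Set.Iio_disjoint_Ici le_rfl),
    unif_Ici h0 hr.le, unif_Iio hr.le, ← ENNReal.ofReal_one, ← ENNReal.ofReal_sub _ h0,
    ENNReal.ofReal_one]
  exact ENNReal.mul_inv_cancel (ENNReal.ofReal_pos.2 (sub_pos.2 hr)).ne' ENNReal.ofReal_ne_top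

theorem unif_enter_diff {a b r : ℝ} (h0 : 0 ≤ a) (hab : a ≤ b) (hbr : b ≤ r) (hr : r < 1) :
    Measure.infinitePi (fun _ : ℕ => unif)
      (enterThrough (Set.Iio r \ Set.Ico a b) (Set.Ici r)) =
      ENNReal.ofReal ((1 - r) / (1 - r + (b - a))) := by
  have hsub : Set.Ico a b ⊆ Set.Iio r := fun x hx => hx.2.trans_le hbr
  rw [infinitePi_enterThrough _ (measurableSet_Iio.diff measurableSet_Ico) measurableSet_Ici
      ((Set.Iio_disjoint_Ici le_rfl).mono_left Set.sdiff_subset),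
    unif_Ici (by linarith) hr.le, measure_sdiff hsub measurableSet_Ico.nullMeasurableSet
      (measure_ne_top _ _), unif_Iio hr.le, unif_apply h0 (by linarith),
    ← ENNReal.ofReal_sub _ (by linarith), ← ENNReal.ofReal_one,
    ← ENNReal.ofReal_sub _ (by linarith), ← ENNReal.ofReal_inv_of_pos (by linarith),
    ← ENNReal.ofReal_mul (by linarith), div_eq_mul_inv]
  congr 3
  ring

variable {W U : ℕ → Ω → ℝ}

theorem IsGEMOneSample.indepFun (h : IsGEMOneSample P W U) :
    (fun ω i => W i ω) ⟂ᵢ[P] (fun ω i => U i ω) := by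
  have hle : ∀ x, MeasurableSpace.comap (Sum.elim W U x) inferInstance ≤ ‹MeasurableSpace Ω› := by
    rintro (i | i)
    · exact (h.measurable_W i).comap_le
    · exact (h.measurable_U i).comap_le
  have hI := indep_iSup_of_disjoint hle h.indep.iIndep
    (S := Set.range Sum.inl) (T := Set.range Sum.inr)
    (Set.disjoint_left.2 (by rintro _ ⟨i, rfl⟩ ⟨j, hj⟩; cases hj))
  rw [IndepFun_iff_Indep]
  simp only [iSup_range, Sum.elim_inl, Sum.elim_inr] at hI
  simp only [MeasurableSpace.pi, MeasurableSpace.comap_iSup, MeasurableSpace.comap_comp]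
  exact hI

theorem IsGEMOneSample.iIndepFun_W (h : IsGEMOneSample P W U) : iIndepFun W P :=
  h.indep.precomp (g := Sum.inl) Sum.inl_injective

theorem IsGEMOneSample.iIndepFun_U (h : IsGEMOneSample P W U) : iIndepFun U P :=
  h.indep.precomp (g := Sum.inr) Sum.inr_injective

/-- Conditioning on `W`: the joint law is a product, with the infinite product of uniform laws as
the law of `U`, so Tonelli applies. -/
theorem IsGEMOneSample.measure_eq_lintegral [IsProbabilityMeasure P] (h : IsGEMOneSample P W U)
    {A : (ℕ → ℝ) → Set (ℕ → ℝ)} (hA : MeasurableSet {p : (ℕ → ℝ) × (ℕ → ℝ) | p.2 ∈ A p.1}) :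
    P {ω | (fun i => U i ω) ∈ A fun i => W i ω} =
      ∫⁻ ω, Measure.infinitePi (fun _ : ℕ => unif) (A fun i => W i ω) ∂P := by
  have mW : Measurable fun ω i => W i ω := measurable_pi_lambda _ h.measurable_W
  have mU : Measurable fun ω i => U i ω := measurable_pi_lambda _ h.measurable_U
  have hU : P.map (fun ω i => U i ω) = Measure.infinitePi fun _ : ℕ => unif := by
    rw [h.iIndepFun_U.map_fun_eq_infinitePi_map h.measurable_U]
    congr 1
    ext1 i
    exact map_eq_unif (h.uniform_U i)
  have hj := (indepFun_iff_map_prod_eq_prod_map_map mW.aemeasurable mU.aemeasurable).1 h.indepFun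
  calc _ = P.map (fun ω => ((fun i => W i ω), (fun i => U i ω)))
        {p : (ℕ → ℝ) × (ℕ → ℝ) | p.2 ∈ A p.1} := by
        rw [Measure.map_apply (mW.prodMk mU) hA]; rfl
    _ = _ := by
        rw [hj, hU, Measure.prod_apply hA, lintegral_map (measurable_measure_prodMk_left hA) mW]
        rfl

/-! ### Probability of an empty interval and the expectation -/

/-- The probability that an interval followed by `n` others is empty when the first sample point
falls beyond the last of them. -/
noncomputable def emptyProb : ℕ → ℝ
  | 0 => 1 / 2
  | 1 => 2 - zetaSum 2
  | n + 2 => 1 - ((n + 2) * zetaSum (n + 3) - (n + 1) * zetaSum (n + 2))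

theorem sum_emptyProb {k : ℕ} (hk : 2 ≤ k) :
    ∑ n ∈ Finset.range k, emptyProb n = 1 / 2 + k - (k - 1) * zetaSum k := by
  induction k, hk using Nat.le_induction with
  | base =>
    simp only [Finset.sum_range_succ, Finset.sum_range_zero, emptyProb]
    push_cast
    ring
  | succ k hk ih =>
    obtain ⟨l, rfl⟩ : ∃ l, k = l + 2 := ⟨k - 2, by omega⟩
    rw [Finset.sum_range_succ, ih, emptyProb]
    push_cast
    ring

/-- Numerator and denominator share the factor `∏ i < j, (1 - w i)`, the stick remaining before the
interval is broken off. -/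
theorem empty_ratio_eq (w : ℕ → ℝ) (hw : ∀ i, w i ∈ Set.Ioo (0 : ℝ) 1) {j k : ℕ} (hj : j < k) :
    (1 - endpoint w k) / (1 - endpoint w k + (endpoint w (j + 1) - endpoint w j)) =
      1 - w j / (w j + (1 - w j) * ∏ i ∈ Finset.Ico (j + 1) k, (1 - w i)) := by
  have hp : ∀ s : Finset ℕ, 0 < ∏ i ∈ s, (1 - w i) := fun s =>
    Finset.prod_pos fun i _ => sub_pos.2 (hw i).2
  have hsplit := Finset.prod_range_mul_prod_Ico (fun i => 1 - w i) (show j + 1 ≤ k from hj)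
  simp only [endpoint_eq, ← hsplit, Finset.prod_range_succ, sub_sub_cancel]
  have hT := hp (Finset.range j)
  have hY := hp (Finset.Ico (j + 1) k)
  generalize ∏ i ∈ Finset.range j, (1 - w i) = T at *
  generalize ∏ i ∈ Finset.Ico (j + 1) k, (1 - w i) = Y at *
  obtain ⟨h0, h1⟩ := hw j
  generalize w j = x at *
  have hD : 0 < x + (1 - x) * Y := add_pos h0 (mul_pos (sub_pos.2 h1) hY)
  have e : T * (1 - x) * Y + (1 - T * (1 - x) - (1 - T)) = T * (x + (1 - x) * Y) := by ring
  rw [e]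
  field_simp
  ring

theorem IsGEMOneSample.integral_ratio [IsProbabilityMeasure P]
    (h : IsGEMOneSample P W U) {j k : ℕ} (hj : j < k) :
    1 - ∫ ω, W j ω / (W j ω + (1 - W j ω) * ∏ i ∈ Finset.Ico (j + 1) k, (1 - W i ω)) ∂P =
      emptyProb (k - 1 - j) := by
  have hlawW : ∀ i, P.map (W i) = unif := fun i => map_eq_unif (h.uniform_W i)
  have hV : ∀ i, Measurable fun ω => 1 - W i ω := fun i => (h.measurable_W i).const_sub 1
  have hlaw : ∀ i, P.map (fun ω => 1 - W i ω) = unif := fun i => by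
    rw [← map_one_sub_unif, ← hlawW i, Measure.map_map (by fun_prop) (h.measurable_W i)]
    rfl
  have hind : iIndepFun (fun i ω => 1 - W i ω) P :=
    h.iIndepFun_W.comp (fun _ x => 1 - x) fun _ => by fun_prop
  have hXs : W j ⟂ᵢ[P] fun ω => ∏ i ∈ Finset.Ico (j + 1) k, (1 - W i ω) := by
    have := (indepFun_prod hV hind (s := Finset.Ico (j + 1) k) (j := j) (by simp)).comp
      (φ := fun x => 1 - x) (ψ := id) (by fun_prop) measurable_id
    convert! this using 1
    ext ω
    simp
  have hcard : (Finset.Ico (j + 1) k).card = k - 1 - j := by simp; omega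
  -- Nonemptiness stays an argument: the last interval has no successors and is treated separately.
  have hsum := fun hs => hasSum_integral_ratio (h.measurable_W j) (hlawW j) hV hlaw hind
    (s := Finset.Ico (j + 1) k) hs hXs
  rw [hcard] at hsum
  rcases hn : k - 1 - j with _ | _ | n
  · have : Finset.Ico (j + 1) k = ∅ := by rw [← Finset.card_eq_zero, hcard, hn]
    simp only [this, Finset.prod_empty, emptyProb]
    rw [integral_ratio_empty (h.measurable_W j) (hlawW j)]
    norm_num
  · rw [hn] at hsum
    rw [(hsum (Finset.nonempty_Ico.2 (by omega))).unique hasSum_moments_one, emptyProb]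
    ring
  · rw [hn] at hsum
    rw [(hsum (Finset.nonempty_Ico.2 (by omega))).unique (hasSum_moments (by omega)), emptyProb]
    push_cast
    ring

theorem IsGEMOneSample.ae_mem_Ioo (h : IsGEMOneSample P W U) :
    ∀ᵐ ω ∂P, ∀ i, W i ω ∈ Set.Ioo (0 : ℝ) 1 :=
  ae_all_iff.2 fun i => StickBreaking.ae_mem_Ioo (h.measurable_W i) (map_eq_unif (h.uniform_W i))

theorem IsGEMOneSample.measurableSet_preimage (h : IsGEMOneSample P W U)
    {A : (ℕ → ℝ) → Set (ℕ → ℝ)} (hA : MeasurableSet {p : (ℕ → ℝ) × (ℕ → ℝ) | p.2 ∈ A p.1}) :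
    MeasurableSet {ω | (fun i => U i ω) ∈ A fun i => W i ω} := by
  have hm : Measurable fun ω => ((fun i => W i ω), (fun i => U i ω)) :=
    (measurable_pi_lambda _ h.measurable_W).prodMk (measurable_pi_lambda _ h.measurable_U)
  exact hm hA

theorem endpoint_lt_one {w : ℕ → ℝ} (hw : ∀ i, w i ∈ Set.Ioo (0 : ℝ) 1) (k : ℕ) :
    endpoint w k < 1 := by
  rw [endpoint_eq, sub_lt_self_iff]
  exact Finset.prod_pos fun i _ => sub_pos.2 (hw i).2

theorem endpoint_nonneg {w : ℕ → ℝ} (hw : ∀ i, w i ∈ Set.Icc (0 : ℝ) 1) (k : ℕ) :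
    0 ≤ endpoint w k := by
  simpa [endpoint] using endpoint_mono hw k.zero_le

theorem IsGEMOneSample.ae_enter [IsProbabilityMeasure P]
    (h : IsGEMOneSample P W U) (k : ℕ) :
    ∀ᵐ ω ∂P, (fun i => U i ω) ∈ enterThrough (Set.Iio (endpoint (fun i => W i ω) k))
      (Set.Ici (endpoint (fun i => W i ω) k)) := by
  have hm : MeasurableSet {ω | (fun i => U i ω) ∈
      enterThrough (Set.Iio (endpoint (fun i => W i ω) k))
        (Set.Ici (endpoint (fun i => W i ω) k))} :=
    h.measurableSet_preimage
      (A := fun w => enterThrough (Set.Iio (endpoint w k)) (Set.Ici (endpoint w k)))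
      (measurableSet_enter k)
  refine (mem_ae_iff_prob_eq_one hm).2 ?_
  rw [h.measure_eq_lintegral
    (A := fun w => enterThrough (Set.Iio (endpoint w k)) (Set.Ici (endpoint w k)))
    (measurableSet_enter k), lintegral_congr_ae (g := fun _ => 1), lintegral_one, measure_univ]
  filter_upwards [h.ae_mem_Ioo] with ω hω
  exact unif_enter (endpoint_nonneg (fun i => Set.Ioo_subset_Icc_self (hω i)) k)
    (endpoint_lt_one hω k)

theorem IsGEMOneSample.measureReal_emptyEvent [IsProbabilityMeasure P]
    (h : IsGEMOneSample P W U) {j k : ℕ} (hj : j < k) :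
    P.real {ω | (fun i => U i ω) ∈ emptyEvent (fun i => W i ω) k j} = emptyProb (k - 1 - j) := by
  have hae : (fun ω => Measure.infinitePi (fun _ : ℕ => unif)
      (emptyEvent (fun i => W i ω) k j)) =ᵐ[P] fun ω => ENNReal.ofReal (1 - W j ω /
        (W j ω + (1 - W j ω) * ∏ i ∈ Finset.Ico (j + 1) k, (1 - W i ω))) := by
    filter_upwards [h.ae_mem_Ioo] with ω hω
    have hI : ∀ i, W i ω ∈ Set.Icc (0 : ℝ) 1 := fun i => Set.Ioo_subset_Icc_self (hω i)
    have hmono := endpoint_mono hI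
    rw [emptyEvent, unif_enter_diff (endpoint_nonneg hI j) (hmono (by omega)) (hmono (by omega))
      (endpoint_lt_one hω k), empty_ratio_eq _ hω hj]
  have hbd : ∀ᵐ ω ∂P, W j ω / (W j ω + (1 - W j ω) * ∏ i ∈ Finset.Ico (j + 1) k, (1 - W i ω)) ∈
      Set.Icc (0 : ℝ) 1 := by
    filter_upwards [h.ae_mem_Ioo] with ω hω
    have hY : 0 ≤ (1 - W j ω) * ∏ i ∈ Finset.Ico (j + 1) k, (1 - W i ω) :=
      mul_nonneg (sub_nonneg.2 (hω j).2.le)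
        (Finset.prod_nonneg fun i _ => sub_nonneg.2 (hω i).2.le)
    exact ⟨div_nonneg (hω j).1.le (add_nonneg (hω j).1.le hY),
      div_le_one_of_le₀ (by linarith) (add_nonneg (hω j).1.le hY)⟩
  have hmeas : Measurable fun ω => W j ω /
      (W j ω + (1 - W j ω) * ∏ i ∈ Finset.Ico (j + 1) k, (1 - W i ω)) := by
    have := h.measurable_W
    fun_prop
  have hint : Integrable (fun ω => W j ω /
      (W j ω + (1 - W j ω) * ∏ i ∈ Finset.Ico (j + 1) k, (1 - W i ω))) P :=
    Integrable.of_bound hmeas.aestronglyMeasurable 1 (by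
      filter_upwards [hbd] with ω hω
      rw [Real.norm_of_nonneg hω.1]
      exact hω.2)
  have hnn : 0 ≤ᵐ[P] fun ω => 1 - W j ω /
      (W j ω + (1 - W j ω) * ∏ i ∈ Finset.Ico (j + 1) k, (1 - W i ω)) := by
    filter_upwards [hbd] with ω hω using sub_nonneg.2 hω.2
  have hint1 : Integrable (fun ω => 1 - W j ω /
      (W j ω + (1 - W j ω) * ∏ i ∈ Finset.Ico (j + 1) k, (1 - W i ω))) P :=
    (integrable_const 1).sub hint
  rw [← h.integral_ratio hj, measureReal_def,
    h.measure_eq_lintegral (A := fun w => emptyEvent w k j)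
    (measurableSet_emptyEvent k j), lintegral_congr_ae hae,
    ← ofReal_integral_eq_lintegral_ofReal hint1 hnn,
    ENNReal.toReal_ofReal (integral_nonneg_of_ae hnn), integral_sub (integrable_const 1) hint]
  simp

theorem IsGEMOneSample.integrable_emptyCount_and_integral [IsProbabilityMeasure P]
    (h : IsGEMOneSample P W U) (k : ℕ) :
    Integrable (fun ω => (emptyCount (fun i => W i ω) (fun i => U i ω) 1 k : ℝ)) P ∧
    ∫ ω, (emptyCount (fun i => W i ω) (fun i => U i ω) 1 k : ℝ) ∂P =
      ∑ n ∈ Finset.range k, emptyProb n := by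
  let A : ℕ → Set Ω := fun j => {ω | (fun i => U i ω) ∈ emptyEvent (fun i => W i ω) k j}
  have hA : ∀ j, MeasurableSet (A j) := fun j =>
    h.measurableSet_preimage (A := fun w => emptyEvent w k j) (measurableSet_emptyEvent k j)
  have hae : (fun ω => (emptyCount (fun i => W i ω) (fun i => U i ω) 1 k : ℝ)) =ᵐ[P]
      fun ω => ∑ j ∈ Finset.range k, (A j).indicator (fun _ => (1 : ℝ)) ω := by
    filter_upwards [h.ae_mem_Ioo, h.ae_enter k] with ω hω hu
    rw [emptyCount_eq_sum_indicator (fun i => Set.Ioo_subset_Icc_self (hω i)) hu]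
    rfl
  have hi : ∀ j, Integrable ((A j).indicator (fun _ => (1 : ℝ))) P := fun j =>
    (integrable_const 1).indicator (hA j)
  refine ⟨(integrable_finsetSum _ fun j _ => hi j).congr hae.symm, ?_⟩
  -- The reflection matches interval `j` with the number `k - 1 - j` of intervals after it.
  rw [integral_congr_ae hae, integral_finsetSum _ fun j _ => hi j,
    ← Finset.sum_range_reflect emptyProb]
  refine Finset.sum_congr rfl fun j hj => ?_
  rw [integral_indicator_const _ (hA j), smul_eq_mul, mul_one,
    h.measureReal_emptyEvent (Finset.mem_range.1 hj)]

end StickBreaking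

/-- Integrability is part of the claim because the integral of a nonintegrable function is `0` by
convention. -/
theorem mainTheorem6 {Ω : Type*} [MeasurableSpace Ω] (P : Measure Ω) [IsProbabilityMeasure P]
    (W U : ℕ → Ω → ℝ) (h : StickBreaking.IsGEMOneSample P W U) (k : ℕ) (hk : 1 ≤ k) :
    Integrable
      (fun ω => (StickBreaking.emptyCount (fun i => W i ω) (fun i => U i ω) 1 k : ℝ)) P ∧
    (k = 1 →
      ∫ ω, (StickBreaking.emptyCount (fun i => W i ω) (fun i => U i ω) 1 k : ℝ) ∂P = 1 / 2) ∧
    (2 ≤ k →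
      ((∫ ω, (StickBreaking.emptyCount (fun i => W i ω) (fun i => U i ω) 1 k : ℝ) ∂P : ℝ) : ℂ) =
        1 / 2 + (k : ℂ) - ((k : ℂ) - 1) * riemannZeta (k : ℂ)) := by
  obtain ⟨hi, hint⟩ := h.integrable_emptyCount_and_integral k
  refine ⟨hi, ?_, fun hk2 => ?_⟩
  · rintro rfl
    rw [hint]
    simp [StickBreaking.emptyProb]
  · rw [hint, StickBreaking.sum_emptyProb hk2, ← StickBreaking.zetaSum_eq_riemannZeta hk2]
    push_cast
    ring
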